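/- Let $\Bbbk$ be a field. Definitions. Let $S=\Bbbk[x_1,\dots,x_N]$ be a polynomial ring. For a total order on the variables, the degree reverse lexicographic (revlex) order compares two monomials first by degree and, in equal degree, declares smaller the one with the larger exponent at the lowest variable where the exponents differ. A homogeneous polynomial $f\in S$ is *tidy* if each variable divides at most one monomial in the support of $f$. An ideal $I\subseteq S$ *has a tidy quadratic revlex-universal Gröbner basis* if there is one finite set $\mathcal G\subseteq I$ of tidy nonzero homogeneous polynomials of degree $2$ that is a Gröbner basis of $I$ with respect to the revlex orders associated with all total orders on the variables. A standard graded $\Bbbk$-algebra $R$ is *strongly Koszul* with respect to a $\Bbbk$-basis $B$ of $R_1$ if, for every $A\subsetneq B$ and every $b\in B\setminus A$, the colon ideal $(a\mid a\in A):_R b$ is generated by elements of $B$. For a matrix $M$ over a commutative ring, $I_2(M)$ is the ideal generated by its $2$-minors. For positive integers $m,n$ and a bipartite graph $G$ on $[m]\sqcup[\tilde n]$ (all edges joining an element of $[m]$ to an element of $[\tilde n]$), let $X^{\mathrm{gen}}_G$ be the $m\times n$ matrix whose $(i,j)$-th entry is $0$ if $\{i,\tilde j\}$ is an edge of $G$ and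 the variable $x_{ij}$ otherwise. For a positive integer $n$ and a graph $H$ on $[n]$, possibly with loops, let $X^{\mathrm{sym}}_H$ be the symmetric $n\times n$ matrix whose $(i,j)$-th and $(j,i)$-th entries, for $i\le j$, are $0$ if $\{i,j\}$ is an edge of $H$ (a loop at $i$ if $i=j$) and the variable $x_{ij}$ otherwise. Theorem. (i) For any $m,n$ and any bipartite graph $G$ as above, the ideal $I_2(X^{\mathrm{gen}}_G)$ of $S=\Bbbk[x_{ij}\mid i\in[m],\,j\in[n]]$ has a tidy quadratic revlex-universal Gröbner basis, and $S/I_2(X^{\mathrm{gen}}_G)$ is a standard graded $\Bbbk$-algebra in which the classes of the variables form a basis of the degree-one part, and which is strongly Koszul with respect to that basis. The same holds when $S$ is replaced by the polynomial ring in only those variables $x_{ij}$ for which $\{i,\tilde j\}$ is not an edge of $G$. (ii) For any $n$ and any graph $H$, possibly with loops, as above, the ideal $I_2(X^{\mathrm{sym}}_H)$ of $S=\Bbbk[x_{ij}\mid 1\le i\le j\le n]$ has a tidy quadratic revlex-universal Gröbner basis, and $S/I_2(X^{\mathrm{sym}}_H)$ is a standard graded $\Bbbk$-algebra in which the classes of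 the variables form a basis of the degree-one part, and which is strongly Koszul with respect to that basis. The same holds when $S$ is replaced by the polynomial ring in only those variables $x_{ij}$ for which $\{i,j\}$ is not an edge (or loop) of $H$. -/

import Mathlib

noncomputable section

namespace SparseMinors

open MvPolynomial

/-! ### Degree reverse lexicographic orders -/

section DegRevLex

variable {σ : Type*}

/-- The exponent vectors of monomials in the variables `σ`, to be ordered by the degree reverse
lexicographic order attached to a total order `o` of the variables. -/
def DegRevLex (_o : LinearOrder σ) : Type _ := σ →₀ ℕ

instance (o : LinearOrder σ) : AddCommMonoid (DegRevLex o) :=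
  inferInstanceAs (AddCommMonoid (σ →₀ ℕ))

/-- The identity map from exponent vectors to `DegRevLex o`. -/
def toDegRevLex (o : LinearOrder σ) : (σ →₀ ℕ) ≃+ DegRevLex o := AddEquiv.refl _

/-- Monomials are compared first by degree, and then by the *reverse* of the comparison of the
exponents at the lowest variable where they differ (see `degRevLex_lt_iff`). -/
def DegRevLex.key (o : LinearOrder σ) (a : DegRevLex o) : ℕ ×ₗ (Lex (σ →₀ ℕ))ᵒᵈ :=
  toLex (((toDegRevLex o).symm a).degree, OrderDual.toDual (toLex ((toDegRevLex o).symm a)))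

theorem DegRevLex.key_injective (o : LinearOrder σ) : Function.Injective (DegRevLex.key o) := by
  intro a b h
  have h2 := congrArg (fun p => (ofLex p).2) h
  exact h2

instance (o : LinearOrder σ) : LinearOrder (DegRevLex o) :=
  LinearOrder.lift' (DegRevLex.key o) (DegRevLex.key_injective o)

theorem DegRevLex.lt_iff (o : LinearOrder σ) (a b : σ →₀ ℕ) :
    toDegRevLex o a < toDegRevLex o b ↔
      a.degree < b.degree ∨ a.degree = b.degree ∧ toLex b < toLex a :=
  Prod.Lex.toLex_lt_toLex

theorem DegRevLex.le_iff (o : LinearOrder σ) (a b : σ →₀ ℕ) :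
    toDegRevLex o a ≤ toDegRevLex o b ↔
      a.degree < b.degree ∨ a.degree = b.degree ∧ toLex b ≤ toLex a :=
  Prod.Lex.toLex_le_toLex

instance (o : LinearOrder σ) : IsOrderedAddMonoid (DegRevLex o) where
  add_le_add_left a b h c := by
    obtain ⟨a, rfl⟩ := (toDegRevLex o).surjective a
    obtain ⟨b, rfl⟩ := (toDegRevLex o).surjective b
    obtain ⟨c, rfl⟩ := (toDegRevLex o).surjective c
    rw [← map_add, ← map_add, DegRevLex.le_iff] at *
    simpa [toLex_add] using h

theorem toDegRevLex_monotone (o : LinearOrder σ) : Monotone (toDegRevLex o) := by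
  intro a b h
  obtain ⟨c, rfl⟩ := exists_add_of_le h
  rw [DegRevLex.le_iff]
  rcases Nat.eq_zero_or_pos c.degree with hc | hc
  · have : c = 0 := (Finsupp.degree_eq_zero_iff c).1 hc
    subst this
    right
    simp
  · left
    rw [map_add]
    omega

instance [Finite σ] (o : LinearOrder σ) : WellFoundedLT (DegRevLex o) := by
  have : WellQuasiOrderedLE (DegRevLex o) :=
    (toDegRevLex_monotone o).wellQuasiOrderedLE_of_wellQuasiOrderedLE_of_surjective
      (toDegRevLex o).surjective
  infer_instance

/-- The degree reverse lexicographic monomial order attached to a total order of the variables. -/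
def degRevLex [Finite σ] (o : LinearOrder σ) : MonomialOrder σ where
  syn := DegRevLex o
  toSyn := toDegRevLex o
  toSyn_monotone := toDegRevLex_monotone o

/-- `x^a < x^b` in the degree reverse lexicographic order iff `x^a` has smaller degree, or the
degrees agree and the lowest variable on which `a` and `b` differ has larger exponent in `a`. -/
theorem degRevLex_lt_iff [Finite σ] (o : LinearOrder σ) (a b : σ →₀ ℕ) :
    (degRevLex o).toSyn a < (degRevLex o).toSyn b ↔
      a.degree < b.degree ∨
        a.degree = b.degree ∧ ∃ i, (∀ j, j < i → a j = b j) ∧ b i < a i := by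
  refine (DegRevLex.lt_iff o a b).trans ?_
  rw [Finsupp.Lex.lt_iff]
  simp only [ofLex_toLex, eq_comm]

end DegRevLex

/-! ### Gröbner bases and tidy polynomials -/

section Groebner

variable {σ k : Type*} [Field k]

/-- `G` is a (finite) Gröbner basis of the ideal `I` with respect to the monomial order `m`: it is
contained in `I` and its leading terms generate the initial ideal of `I`. -/
structure IsGroebnerBasis (m : MonomialOrder σ) (G : Set (MvPolynomial σ k))
    (I : Ideal (MvPolynomial σ k)) : Prop where
  finite : G.Finite
  subset : G ⊆ I
  span_leadingTerm : Ideal.span (m.leadingTerm '' G) =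
    Ideal.span (m.leadingTerm '' (I : Set (MvPolynomial σ k)))

/-- A homogeneous polynomial is tidy if each variable divides at most one monomial of its
support. -/
structure IsTidy (f : MvPolynomial σ k) : Prop where
  homogeneous : ∃ d, f.IsHomogeneous d
  unique : ∀ s : σ, ∀ a ∈ f.support, ∀ b ∈ f.support, a s ≠ 0 → b s ≠ 0 → a = b

/-- `I` has a tidy quadratic revlex-universal Gröbner basis: one set of tidy nonzero quadrics that
is a Gröbner basis for the degree reverse lexicographic orders of all orderings of the variables. -/
def HasTidyQuadraticRevlexUniversalGB [Finite σ] (I : Ideal (MvPolynomial σ k)) : Prop :=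
  ∃ G : Set (MvPolynomial σ k),
    (∀ g ∈ G, IsTidy g) ∧ (∀ g ∈ G, g ≠ 0 ∧ g.IsHomogeneous 2) ∧
      ∀ o : LinearOrder σ, IsGroebnerBasis (degRevLex o) G I

end Groebner

/-! ### Strongly Koszul algebras -/

section StronglyKoszul

variable {k R ι : Type*} [Field k] [CommRing R] [Algebra k R]

/-- `R = ⨁ 𝒜 d` is a standard graded `k`-algebra: it is graded, its degree zero part is `k`, and it
is generated as a `k`-algebra by its finite-dimensional degree one part. -/
structure IsStandardGraded (𝒜 : ℕ → Submodule k R) : Prop where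
  gradedMonoid : SetLike.GradedMonoid 𝒜
  isInternal : DirectSum.IsInternal 𝒜
  nontrivial : Nontrivial R
  zero_eq : 𝒜 0 = 1
  adjoin_one : Algebra.adjoin k (𝒜 1 : Set R) = ⊤
  finite_one : Module.Finite k (𝒜 1)

/-- The standard graded algebra `R = ⨁ 𝒜 d` is strongly Koszul with respect to the `k`-basis `b` of
`𝒜 1`: for all sets `A` of basis elements and all basis elements `b i` outside `A`, the colon ideal
`(A) : b i` is generated by basis elements. -/
structure IsStronglyKoszul (𝒜 : ℕ → Submodule k R) (b : ι → R) : Prop where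
  isStandardGraded : IsStandardGraded 𝒜
  linearIndependent : LinearIndependent k b
  span_range : Submodule.span k (Set.range b) = 𝒜 1
  colon_eq : ∀ A : Set ι, ∀ i ∉ A, ∃ C : Set ι,
    (Ideal.span (b '' A)).colon {b i} = Ideal.span (b '' C)

/-- The pieces of the quotient of a polynomial ring by an ideal: the classes of the homogeneous
polynomials of degree `d`. -/
def quotientGrading {σ : Type*} (I : Ideal (MvPolynomial σ k)) (d : ℕ) :
    Submodule k (MvPolynomial σ k ⧸ I) :=
  (homogeneousSubmodule σ k d).map (Ideal.Quotient.mkₐ k I).toLinearMap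

/-- `k[σ]/I` is strongly Koszul with respect to the variables. -/
def IsStronglyKoszulQuotient {σ : Type*} (I : Ideal (MvPolynomial σ k)) : Prop :=
  IsStronglyKoszul (quotientGrading I) (fun s : σ => Ideal.Quotient.mk I (X s))

end StronglyKoszul

/-! ### Sparse generic matrices and their minors -/

section Matrices

/-- The ideal generated by the `t`-minors of a matrix. -/
def minorsIdeal {R : Type*} [CommRing R] {m n : ℕ} (t : ℕ) (M : Matrix (Fin m) (Fin n) R) :
    Ideal R :=
  Ideal.span {f | ∃ (r : Fin t ↪o Fin m) (c : Fin t ↪o Fin n), f = (M.submatrix r c).det}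

variable (k : Type*) [Field k] {m n : ℕ}

open Classical in
/-- The sparse generic matrix over `k[x_ij | i ∈ [m], j ∈ [n]]`: the `(i,j)`-th entry is zero if
`{i, j}` is an edge of the graph and the variable `x_ij` otherwise. -/
def sparseGenericMatrix (G : SimpleGraph (Fin m ⊕ Fin n)) :
    Matrix (Fin m) (Fin n) (MvPolynomial (Fin m × Fin n) k) :=
  Matrix.of fun i j => if G.Adj (Sum.inl i) (Sum.inr j) then 0 else X (i, j)

open Classical in
/-- The same matrix over the polynomial ring in the surviving variables only. -/
def sparseGenericMatrixSurviving (G : SimpleGraph (Fin m ⊕ Fin n)) :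
    Matrix (Fin m) (Fin n)
      (MvPolynomial {p : Fin m × Fin n // ¬ G.Adj (Sum.inl p.1) (Sum.inr p.2)} k) :=
  Matrix.of fun i j =>
    if h : G.Adj (Sum.inl i) (Sum.inr j) then 0 else X ⟨(i, j), h⟩

open Classical in
/-- The sparse generic symmetric matrix over `k[x_ij | 1 ≤ i ≤ j ≤ n]`, the variables being indexed
by unordered pairs. The graph, possibly with loops, is given by its set `H` of edges; the entries
at `(i,j)` and `(j,i)` are zero if `{i,j}` is an edge (a loop if `i = j`). -/
def sparseSymmetricMatrix (H : Set (Sym2 (Fin n))) :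
    Matrix (Fin n) (Fin n) (MvPolynomial (Sym2 (Fin n)) k) :=
  Matrix.of fun i j => if s(i, j) ∈ H then 0 else X s(i, j)

open Classical in
/-- The same matrix over the polynomial ring in the surviving variables only. -/
def sparseSymmetricMatrixSurviving (H : Set (Sym2 (Fin n))) :
    Matrix (Fin n) (Fin n) (MvPolynomial {e : Sym2 (Fin n) // e ∉ H} k) :=
  Matrix.of fun i j => if h : s(i, j) ∈ H then 0 else X ⟨s(i, j), h⟩

end Matrices

end SparseMinors

end

/-! Grade each variable at position (i,j) by the sum of its row label and its column label (distinct
labels for a generic matrix, one common set of labels for a symmetric one), and let `T` be the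
degrees of the zero positions. A 2-minor with four nonzero entries is a difference of two monomials
of equal degree. In a 2-minor with a zero entry, every surviving monomial has degree divisible by an
element of `T`. The combinatorial core is an exchange property. If the degree of a monomial u is
divisible by that of position (i,j), but u is not divisible by the entry there, then u is divisible
by yz with y in row i and z in column j. The minor on these positions trades yz for xw, where x is
the entry at (i,j), or shows that yz is in the ideal when one of x, w is zero. `IsSwapSystem`
abstracts exactly this. Two consequences carry the theorem. For Gröbner bases (`exists_degree_le`):
if a leading monomial u shares its degree with a smaller v in the support, the lowest variable x
where they differ is more frequent in v. After removal of the gcd, every variable of u exceeds x, so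
the traded yz is the revlex leading term of yz - xw whatever w is. Only the order relative to x
matters, so the same minors serve all variable orders. For colon ideals (`mem_of_mul_X_mem`): a term
of f is either removed by a same-degree binomial or detected by a quadric yz, and such a quadric
places that term in an ideal generated by the minors and variables. -/

noncomputable section

namespace SparseMinors

open MvPolynomial

/-! ### Monomial rewriting modulo a grading with killed degrees -/

section SwapSystem

variable {σ k M : Type*} [Field k] [AddCommMonoid M]

/-- The ring homomorphism of monoid algebras induced by a grading `D` of the monomials. -/
def gradingMap (k : Type*) [Field k] (D : (σ →₀ ℕ) →+ M) :
    MvPolynomial σ k →+* AddMonoidAlgebra k M :=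
  AddMonoidAlgebra.mapDomainRingHom k D

/-- The polynomials whose `D`-graded sums of coefficients vanish outside of the ideal of `M`
generated by `T`. -/
def gradedIdeal (k : Type*) [Field k] (D : (σ →₀ ℕ) →+ M) (T : Set M) :
    Ideal (MvPolynomial σ k) :=
  (Ideal.span (AddMonoidAlgebra.of' k M '' T)).comap (gradingMap k D)

theorem gradingMap_monomial (D : (σ →₀ ℕ) →+ M) (u : σ →₀ ℕ) (c : k) :
    gradingMap k D (monomial u c) = AddMonoidAlgebra.single (D u) c := by
  simp [gradingMap, monomial]

/-- The image of f has at D u the sum of the coefficients of f over the fibre of D through u. If u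
is alone in its fibre, this sum is nonzero, and membership in a monomial ideal forces D u to be
divisible by an element of T. All later arguments start from this dichotomy. -/
theorem exists_of_mem_gradedIdeal {D : (σ →₀ ℕ) →+ M} {T : Set M} {f : MvPolynomial σ k}
    (hf : f ∈ gradedIdeal k D T) {u : σ →₀ ℕ} (hu : u ∈ f.support) :
    (∃ t ∈ T, ∃ m, D u = m + t) ∨ ∃ v ∈ f.support, v ≠ u ∧ D v = D u := by
  classical
  by_contra! h
  obtain ⟨h1, h2⟩ := h
  have hc : (gradingMap k D f).coeff (D u) = coeff u f := by
    rw [f.as_sum, map_sum]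
    simp only [gradingMap_monomial, AddMonoidAlgebra.coeff_sum, Finsupp.finsetSum_apply,
      AddMonoidAlgebra.coeff_single]
    rw [Finset.sum_eq_single u]
    · rw [← f.as_sum]; simp
    · intro v hv hvu
      exact Finsupp.single_eq_of_ne (h2 v hv hvu).symm
    · exact fun h => absurd hu h
  have hf' := AddMonoidAlgebra.mem_ideal_span_of'_image.1 (Ideal.mem_comap.1 hf) (D u) (by
    rw [Finsupp.mem_support_iff, hc]; exact mem_support_iff.1 hu)
  obtain ⟨t, ht, m, hm⟩ := hf'
  exact h1 t ht m hm

theorem monomial_mem_gradedIdeal {D : (σ →₀ ℕ) →+ M} {T : Set M} {u : σ →₀ ℕ} {m t : M}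
    (ht : t ∈ T) (hu : D u = m + t) (c : k) : monomial u c ∈ gradedIdeal k D T := by
  refine Ideal.mem_comap.2 (AddMonoidAlgebra.mem_ideal_span_of'_image.2 fun x hx => ?_)
  rw [gradingMap_monomial] at hx
  obtain rfl := Finset.mem_singleton.mp (Finsupp.support_single_subset hx)
  exact ⟨t, ht, m, hu⟩

theorem gradedIdeal_mono {D : (σ →₀ ℕ) →+ M} {T T' : Set M} (h : T ⊆ T') :
    gradedIdeal k D T ≤ gradedIdeal k D T' :=
  Ideal.comap_mono (Ideal.span_mono (Set.image_mono h))

theorem exists_grade_of_monomial_mem {D : (σ →₀ ℕ) →+ M} {T : Set M} {u : σ →₀ ℕ}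
    (h : monomial u (1 : k) ∈ gradedIdeal k D T) : ∃ t ∈ T, ∃ m, D u = m + t := by
  classical
  have hs : (monomial u (1 : k)).support = {u} := by
    rw [support_monomial, if_neg one_ne_zero]
  rcases exists_of_mem_gradedIdeal h (u := u) (by simp [hs]) with h | ⟨v, hv, hvu, -⟩
  · exact h
  · rw [hs] at hv
    exact absurd (Finset.mem_singleton.1 hv) hvu

/-- A finite set `G` of tidy quadrics that contains, up to sign, enough binomials `y z - x w` and
monomials `y z` to rewrite monomials modulo the grading `D` and the killed degrees `T`: a monomial
whose degree is divisible by that of the variable `x` but which is not itself divisible by `x` can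
be rewritten, and a monomial with a killed degree is a multiple of an element of `G`. -/
structure IsSwapSystem (D : (σ →₀ ℕ) →+ M) (T : Set M) (G : Set (MvPolynomial σ k)) : Prop where
  finite : G.Finite
  tidy : ∀ g ∈ G, IsTidy g
  ne_zero : ∀ g ∈ G, g ≠ 0
  quadratic : ∀ g ∈ G, g.IsHomogeneous 2
  graded : ∀ g ∈ G, g ∈ gradedIdeal k D T
  degree_eq : ∀ u v, D u = D v → u.degree = v.degree
  swap : ∀ (x : σ) (u : σ →₀ ℕ) (m : M), D u = m + D (Finsupp.single x 1) → u x = 0 →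
    ∃ y z, Finsupp.single y 1 + Finsupp.single z 1 ≤ u ∧
      ((∃ g ∈ G, g = X y * X z ∨ g = -(X y * X z)) ∨
        ∃ w, D (Finsupp.single y 1 + Finsupp.single z 1) =
            D (Finsupp.single x 1 + Finsupp.single w 1) ∧
          ∃ g ∈ G, g = X y * X z - X x * X w ∨ g = -(X y * X z - X x * X w))
  kill : ∀ (u : σ →₀ ℕ) (m : M), ∀ t ∈ T, D u = m + t →
    ∃ y z, Finsupp.single y 1 + Finsupp.single z 1 ≤ u ∧
      ∃ g ∈ G, g = X y * X z ∨ g = -(X y * X z)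

theorem X_mul_X_eq_monomial (y z : σ) :
    (X y * X z : MvPolynomial σ k) = monomial (Finsupp.single y 1 + Finsupp.single z 1) 1 := by
  simp [X, monomial_mul]

theorem monomial_mem_of_le {I : Ideal (MvPolynomial σ k)} {u v : σ →₀ ℕ} (h : v ≤ u)
    (hv : monomial v (1 : k) ∈ I) (c : k) : monomial u c ∈ I := by
  have : monomial u c = monomial (u - v) c * monomial v (1 : k) := by
    rw [monomial_mul, mul_one, tsub_add_cancel_of_le h]
  rw [this]
  exact I.mul_mem_left _ hv

theorem mem_of_mem_or_neg {G : Set (MvPolynomial σ k)} {f : MvPolynomial σ k}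
    (h : ∃ g ∈ G, g = f ∨ g = -f) : f ∈ Ideal.span G := by
  obtain ⟨g, hg, rfl | rfl⟩ := h
  · exact Ideal.subset_span hg
  · exact (Ideal.neg_mem_iff _).1 (Ideal.subset_span hg)

namespace IsSwapSystem

variable {D : (σ →₀ ℕ) →+ M} {T : Set M} {G : Set (MvPolynomial σ k)}

theorem span_le (h : IsSwapSystem D T G) : Ideal.span G ≤ gradedIdeal k D T :=
  Ideal.span_le.2 h.graded

theorem monomial_mem (h : IsSwapSystem D T G) {u : σ →₀ ℕ} {m t : M} (ht : t ∈ T)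
    (hu : D u = m + t) (c : k) : monomial u c ∈ Ideal.span G := by
  obtain ⟨y, z, hyz, hg⟩ := h.kill u m t ht hu
  refine monomial_mem_of_le hyz ?_ c
  rw [← X_mul_X_eq_monomial]
  exact mem_of_mem_or_neg hg

/-- Monomials of the same `D`-degree agree modulo the ideal generated by a swap system. -/
theorem monomial_sub_monomial_mem [IsCancelAdd M] (h : IsSwapSystem D T G) {u v : σ →₀ ℕ} (huv : D u = D v) :
    monomial u (1 : k) - monomial v 1 ∈ Ideal.span G := by
  induction hn : v.degree generalizing u v with
  | zero =>
    have hu : u.degree = 0 := (h.degree_eq u v huv).trans hn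
    rw [(Finsupp.degree_eq_zero_iff _).1 hn, (Finsupp.degree_eq_zero_iff _).1 hu, sub_self]
    exact Ideal.zero_mem _
  | succ n ih =>
    have hv0 : v ≠ 0 := by rintro rfl; simp at hn
    obtain ⟨x, hx⟩ := Finsupp.support_nonempty_iff.2 hv0
    have hx' : Finsupp.single x 1 ≤ v := by
      rw [Finsupp.single_le_iff]
      exact Nat.one_le_iff_ne_zero.2 (Finsupp.mem_support_iff.1 hx)
    obtain ⟨v, rfl⟩ := exists_add_of_le hx'
    have hdeg : v.degree = n := by
      rw [map_add, Finsupp.degree_single] at hn; omega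
    -- Once x divides both monomials, D(x) cancels and the induction hypothesis applies. If x does
    -- not divide u, one swap either makes it do so or shows u to be in the ideal.
    have key : ∀ u, D (Finsupp.single x 1 + u) = D (Finsupp.single x 1 + v) →
        monomial (Finsupp.single x 1 + u) (1 : k) - monomial (Finsupp.single x 1 + v) 1
          ∈ Ideal.span G := by
      intro u huv
      rw [map_add, map_add] at huv
      have := Ideal.mul_mem_left _ (monomial (Finsupp.single x 1) (1 : k))
        (ih (add_left_cancel huv) hdeg)
      simpa [mul_sub, monomial_mul] using this
    by_cases hux : u x = 0
    · obtain ⟨y, z, hyz, hg⟩ := h.swap x u (D v) (by rw [huv, map_add, add_comm]) hux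
      obtain ⟨u, rfl⟩ := exists_add_of_le hyz
      rcases hg with hg | ⟨w, hw, hg⟩
      -- Here u itself lies in the ideal, so its degree is killed. As v has the same degree, it lies
      -- in the ideal too.
      · have hmem : monomial (Finsupp.single y 1 + Finsupp.single z 1 + u) (1 : k)
            ∈ Ideal.span G := by
          refine monomial_mem_of_le hyz ?_ 1
          rw [← X_mul_X_eq_monomial]
          exact mem_of_mem_or_neg hg
        obtain ⟨t, ht, m, hm⟩ := exists_grade_of_monomial_mem (h.span_le hmem)
        exact sub_mem hmem (h.monomial_mem ht (huv.symm.trans hm) 1)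
      · have h1 := Ideal.mul_mem_left _ (monomial u (1 : k)) (mem_of_mem_or_neg hg)
        rw [X_mul_X_eq_monomial, X_mul_X_eq_monomial, mul_sub, monomial_mul, monomial_mul,
          mul_one, add_comm u, add_comm u, add_assoc (Finsupp.single x 1)] at h1
        have h2 := key (Finsupp.single w 1 + u) (by
          rw [← huv, ← add_assoc, map_add, ← hw, ← map_add])
        simpa using add_mem h1 h2
    · have hx' : Finsupp.single x 1 ≤ u := by
        rw [Finsupp.single_le_iff]
        exact Nat.one_le_iff_ne_zero.2 hux
      obtain ⟨u, rfl⟩ := exists_add_of_le hx'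
      exact key u huv

/-- If `f` times a variable lies in the ideal generated by `G` and a set of further variables, then
`f` lies in an ideal generated by `G` and variables. -/
theorem mem_of_mul_X_mem [IsCancelAdd M] (h : IsSwapSystem D T G) {A : Set σ} {i : σ} (hi : i ∉ A)
    {f : MvPolynomial σ k} (hf : f * X i ∈ Ideal.span G ⊔ Ideal.span (X '' A)) :
    f ∈ Ideal.span G ⊔ Ideal.span
      (X '' (A ∪ {y | X y * X i ∈ Ideal.span G ⊔ Ideal.span (X '' A)})) := by
  classical
  set J : Ideal (MvPolynomial σ k) := Ideal.span G ⊔ Ideal.span (X '' A)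
  set K : Set σ := A ∪ {y | X y * X i ∈ J}
  have hJC : J ≤ Ideal.span G ⊔ Ideal.span (X '' K) :=
    sup_le_sup_left (Ideal.span_mono (Set.image_mono Set.subset_union_left)) _
  have hvar : ∀ c ∈ K, ∀ u : σ →₀ ℕ, u c ≠ 0 → ∀ a : k,
      monomial u a ∈ Ideal.span G ⊔ Ideal.span (X '' K) := by
    intro c hc u huc a
    refine monomial_mem_of_le (v := Finsupp.single c 1) ?_ ?_ a
    · rw [Finsupp.single_le_iff]; exact Nat.one_le_iff_ne_zero.2 huc
    · exact Ideal.mem_sup_right (Ideal.subset_span ⟨c, hc, rfl⟩)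
  -- Killing the degrees of the variables in A as well makes the fibre dichotomy available for J.
  have hJle : J ≤ gradedIdeal k D (T ∪ (fun a => D (Finsupp.single a 1)) '' A) := by
    refine sup_le (h.span_le.trans (gradedIdeal_mono Set.subset_union_left))
      (Ideal.span_le.2 ?_)
    rintro _ ⟨a, ha, rfl⟩
    exact monomial_mem_gradedIdeal (t := D (Finsupp.single a 1)) (m := 0)
      (Or.inr ⟨a, ha, rfl⟩) (zero_add _).symm 1
  induction hn : f.support.card using Nat.strong_induction_on generalizing f with
  | _ n ih =>
    rcases eq_or_ne f 0 with rfl | hf0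
    · exact Ideal.zero_mem _
    obtain ⟨u, hu⟩ := support_nonempty.2 hf0
    have reduce : ∀ p : MvPolynomial σ k, p ∈ Ideal.span G ⊔ Ideal.span (X '' K) →
        p * X i ∈ J → (f - p).support ⊆ f.support.erase u →
        f ∈ Ideal.span G ⊔ Ideal.span (X '' K) := by
      intro p hp hpi hs
      have h1 : (f - p).support.card < n := by
        rw [← hn]
        exact (Finset.card_le_card hs).trans_lt (Finset.card_erase_lt_of_mem hu)
      have h2 := ih _ h1 (f := f - p) (by rw [sub_mul]; exact sub_mem hf hpi) rfl
      simpa using add_mem h2 hp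
    have hui : u + Finsupp.single i 1 ∈ (f * X i).support := by
      rw [mem_support_iff, coeff_mul_X]; exact mem_support_iff.1 hu
    have hmulX : ∀ a : k, monomial u a * X i = monomial (u + Finsupp.single i 1) a := by
      intro a; rw [X, monomial_mul, mul_one]
    have hmono : monomial u (coeff u f) ∈ Ideal.span G ⊔ Ideal.span (X '' K) →
        monomial u (coeff u f) * X i ∈ J → f ∈ Ideal.span G ⊔ Ideal.span (X '' K) := by
      refine fun h1 h2 => reduce _ h1 h2 fun w hw => ?_
      rw [mem_support_iff, coeff_sub, coeff_monomial] at hw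
      rw [Finset.mem_erase, mem_support_iff]
      by_cases huw : u = w
      · subst huw; simp at hw
      · rw [if_neg huw, sub_zero] at hw
        exact ⟨Ne.symm huw, hw⟩
    -- A quadric yz of J dividing u x_i settles the term u: if y or z is x_i, the other factor
    -- divides u and belongs to K; otherwise yz already divides u.
    have hquad : ∀ y z, Finsupp.single y 1 + Finsupp.single z 1 ≤ u + Finsupp.single i 1 →
        X y * X z ∈ J → f ∈ Ideal.span G ⊔ Ideal.span (X '' K) := by
      intro y z hyz hmem
      refine hmono ?_ ?_
      · by_cases hy : y = i
        · subst hy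
          refine hvar z (Or.inr (by rwa [mul_comm] at hmem)) u ?_ _
          have := hyz z
          simp only [Finsupp.add_apply, Finsupp.single_eq_same] at this
          omega
        by_cases hz : z = i
        · subst hz
          refine hvar y (Or.inr hmem) u ?_ _
          have := hyz y
          simp only [Finsupp.add_apply, Finsupp.single_eq_same] at this
          omega
        rw [X_mul_X_eq_monomial] at hmem
        refine hJC (monomial_mem_of_le (fun s => ?_) hmem _)
        by_cases hs : s = i
        · subst hs
          simp [Ne.symm hy, Ne.symm hz]
        · simpa [Finsupp.single_apply, Ne.symm hs] using hyz s
      · rw [hmulX]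
        rw [X_mul_X_eq_monomial] at hmem
        exact monomial_mem_of_le hyz hmem _
    rcases exists_of_mem_gradedIdeal (hJle hf) hui with ⟨t, ht, m, hm⟩ | ⟨v, hv, hvu, hD⟩
    · rcases ht with ht | ⟨a, ha, rfl⟩
      · obtain ⟨y, z, hyz, hg⟩ := h.kill _ m t ht hm
        exact hquad y z hyz (Ideal.mem_sup_left (mem_of_mem_or_neg hg))
      · have hXa : X a ∈ J := Ideal.mem_sup_right (Ideal.subset_span ⟨a, ha, rfl⟩)
        by_cases hua : u a = 0
        · have hai : a ≠ i := fun h => hi (h ▸ ha)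
          -- Modulo x_a the binomial yz - x_a w becomes the monomial yz.
          obtain ⟨y, z, hyz, hg⟩ := h.swap a _ m hm (by simp [hua, hai])
          refine hquad y z hyz ?_
          rcases hg with hg | ⟨w, -, hg⟩
          · exact Ideal.mem_sup_left (mem_of_mem_or_neg hg)
          · have h1 : X y * X z - X a * X w ∈ J := Ideal.mem_sup_left (mem_of_mem_or_neg hg)
            simpa using add_mem h1 (J.mul_mem_right (X w) hXa)
        · refine hmono (hvar a (Or.inl ha) u hua _) (J.mul_mem_right _ ?_)
          refine monomial_mem_of_le (v := Finsupp.single a 1) ?_ hXa _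
          rw [Finsupp.single_le_iff]; exact Nat.one_le_iff_ne_zero.2 hua
    -- Another term v x_i has the degree of u x_i. Cancelling D(x_i) makes u - v an element of the
    -- ideal; subtracting its multiple removes u from f and adds no new monomial.
    · rw [support_mul_X, Finset.mem_map] at hv
      obtain ⟨v, hv, rfl⟩ := hv
      rw [addRightEmbedding_apply, map_add, map_add] at hD
      have hDv := add_right_cancel hD
      have hne : v ≠ u := by rintro rfl; exact hvu rfl
      have hmem : C (coeff u f) * (monomial u (1 : k) - monomial v 1) ∈ Ideal.span G :=
        Ideal.mul_mem_left _ _ (h.monomial_sub_monomial_mem hDv.symm)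
      refine reduce _ (Ideal.mem_sup_left hmem)
        (Ideal.mul_mem_right _ _ (Ideal.mem_sup_left hmem)) fun w hw => ?_
      rw [mem_support_iff, coeff_sub, coeff_C_mul, coeff_sub, coeff_monomial,
        coeff_monomial] at hw
      rw [Finset.mem_erase]
      by_cases huw : u = w
      · subst huw; simp [hne] at hw
      · refine ⟨Ne.symm huw, ?_⟩
        by_cases hvw : v = w
        · exact hvw ▸ hv
        · rw [if_neg huw, if_neg hvw] at hw
          rw [mem_support_iff]
          simpa using hw

end IsSwapSystem
end SwapSystem

/-! ### Leading terms for all revlex orders -/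

section GroebnerBasis

variable {σ k M : Type*} [Field k] [AddCommMonoid M]

/-- The smaller of x and w divides xw but not yz, and no lower variable occurs in either product; so
w may be arbitrary. -/
theorem degRevLex_lt_of_forall_lt [Finite σ] (o : LinearOrder σ) {x y z w : σ}
    (hy : x < y) (hz : x < z) :
    (degRevLex o).toSyn (Finsupp.single x 1 + Finsupp.single w 1) <
      (degRevLex o).toSyn (Finsupp.single y 1 + Finsupp.single z 1) := by
  rw [degRevLex_lt_iff]
  refine Or.inr ⟨by simp, ?_⟩
  rcases le_total x w with hw | hw
  · refine ⟨x, fun j hj => ?_, ?_⟩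
    · simp [hj.ne', (hj.trans hy).ne', (hj.trans hz).ne',
        (hj.trans_le hw).ne']
    · simp [Finsupp.single_apply, hy.ne', hz.ne']
  · refine ⟨w, fun j hj => ?_, ?_⟩
    · have hjx := hj.trans_le hw
      simp [hj.ne', (hjx.trans hy).ne', (hjx.trans hz).ne', hjx.ne']
    · simp [Finsupp.single_apply, (hw.trans_lt hy).ne', (hw.trans_lt hz).ne']

theorem degree_X_mul_X (m : MonomialOrder σ) (y z : σ) :
    m.degree (X y * X z : MvPolynomial σ k) = Finsupp.single y 1 + Finsupp.single z 1 := by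
  classical
  rw [X_mul_X_eq_monomial, MonomialOrder.degree_monomial, if_neg one_ne_zero]

namespace IsSwapSystem

variable {D : (σ →₀ ℕ) →+ M} {T : Set M} {G : Set (MvPolynomial σ k)}

/-- The leading monomial of an element of the ideal generated by a swap system is a multiple of the
leading monomial of an element of the system. -/
theorem exists_degree_le [Finite σ] [IsCancelAdd M] (h : IsSwapSystem D T G) (o : LinearOrder σ)
    {f : MvPolynomial σ k} (hf : f ∈ Ideal.span G) (hf0 : f ≠ 0) :
    ∃ g ∈ G, (degRevLex o).degree g ≤ (degRevLex o).degree f := by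
  set u := (degRevLex o).degree f
  have hus : u ∈ f.support := (degRevLex o).degree_mem_support hf0
  have hlead : ∀ y z, (∃ g ∈ G, g = X y * X z ∨ g = -(X y * X z)) →
      ∃ g ∈ G, (degRevLex o).degree g = Finsupp.single y 1 + Finsupp.single z 1 := by
    rintro y z ⟨g, hg, rfl | rfl⟩
    · exact ⟨_, hg, degree_X_mul_X _ y z⟩
    · exact ⟨_, hg, by rw [MonomialOrder.degree_neg, degree_X_mul_X]⟩
  rcases exists_of_mem_gradedIdeal (h.span_le hf) hus with ⟨t, ht, m, hm⟩ | ⟨v, hv, hvu, hD⟩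
  · obtain ⟨y, z, hyz, hg⟩ := h.kill u m t ht hm
    obtain ⟨g, hg, hgd⟩ := hlead y z hg
    exact ⟨g, hg, hgd ▸ hyz⟩
  · have hlt : (degRevLex o).toSyn v < (degRevLex o).toSyn u :=
      lt_of_le_of_ne ((degRevLex o).le_degree hv)
        (fun h => hvu ((degRevLex o).toSyn.injective h))
    rw [degRevLex_lt_iff] at hlt
    have hdeg := h.degree_eq v u hD
    obtain h' | ⟨-, x, hx, hxlt⟩ := hlt
    · omega
    -- Removing the gcd leaves x dividing only the v side, which is what `swap` requires.
    have hD' : D (u - u ⊓ v) = D (v - u ⊓ v) := by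
      have h1 : D (u - u ⊓ v) + D (u ⊓ v) = D u := by
        rw [← map_add, tsub_add_cancel_of_le inf_le_left]
      have h2 : D (v - u ⊓ v) + D (u ⊓ v) = D v := by
        rw [← map_add, tsub_add_cancel_of_le inf_le_right]
      exact add_right_cancel (h1.trans (hD.symm.trans h2.symm))
    have hxv : Finsupp.single x 1 ≤ v - u ⊓ v := by
      rw [Finsupp.single_le_iff]
      simp only [Finsupp.tsub_apply, Finsupp.inf_apply]
      have : u x ⊓ v x = u x := inf_eq_left.2 hxlt.le
      omega
    obtain ⟨y, z, hyz, hg⟩ := h.swap x (u - u ⊓ v) (D (v - u ⊓ v - Finsupp.single x 1))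
      (by rw [← map_add, tsub_add_cancel_of_le hxv, hD'])
      (by
        simp only [Finsupp.tsub_apply, Finsupp.inf_apply]
        rw [inf_eq_left.2 hxlt.le, tsub_self])
    have hyzu := hyz.trans (tsub_le_self (a := u) (b := u ⊓ v))
    rcases hg with hg | ⟨w, -, hg⟩
    · obtain ⟨g, hg, hgd⟩ := hlead y z hg
      exact ⟨g, hg, hgd ▸ hyzu⟩
    -- Below x the exponents of u and v agree, and at x that of v is larger, so the reduced u
    -- involves only variables above x.
    · have hpos : ∀ s, (u - u ⊓ v) s ≠ 0 → x < s := by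
        intro s hs
        by_contra hsx
        apply hs
        simp only [Finsupp.tsub_apply, Finsupp.inf_apply]
        rcases (not_lt.1 hsx).eq_or_lt with rfl | hsx
        · rw [inf_eq_left.2 hxlt.le, tsub_self]
        · rw [hx s hsx, inf_idem, tsub_self]
      have hy : x < y := hpos y (by
        have := hyz y
        simp only [Finsupp.add_apply, Finsupp.single_eq_same] at this
        omega)
      have hz : x < z := hpos z (by
        have := hyz z
        simp only [Finsupp.add_apply, Finsupp.single_eq_same] at this
        omega)
      have hd : (degRevLex o).degree (X y * X z - X x * X w : MvPolynomial σ k) =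
          Finsupp.single y 1 + Finsupp.single z 1 := by
        rw [MonomialOrder.degree_sub_of_lt, degree_X_mul_X]
        rw [degree_X_mul_X, degree_X_mul_X]
        exact degRevLex_lt_of_forall_lt o hy hz
      obtain ⟨g, hg, rfl | rfl⟩ := hg
      · exact ⟨_, hg, hd ▸ hyzu⟩
      · exact ⟨_, hg, by rw [MonomialOrder.degree_neg, hd]; exact hyzu⟩

theorem hasTidyQuadraticRevlexUniversalGB [Finite σ] [IsCancelAdd M] (h : IsSwapSystem D T G) :
    HasTidyQuadraticRevlexUniversalGB (Ideal.span G) := by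
  refine ⟨G, h.tidy, fun g hg => ⟨h.ne_zero g hg, h.quadratic g hg⟩, fun o =>
    ⟨h.finite, Ideal.subset_span, ?_⟩⟩
  refine le_antisymm (Ideal.span_mono (Set.image_mono Ideal.subset_span)) (Ideal.span_le.2 ?_)
  rintro _ ⟨f, hf, rfl⟩
  rcases eq_or_ne f 0 with rfl | hf0
  · simp
  obtain ⟨g, hg, hle⟩ := h.exists_degree_le o hf hf0
  have hlc : (degRevLex o).leadingCoeff g ≠ 0 :=
    MonomialOrder.leadingCoeff_ne_zero_iff.2 (h.ne_zero g hg)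
  refine monomial_mem_of_le hle ?_ _
  have := Ideal.mul_mem_left (Ideal.span ((degRevLex o).leadingTerm '' G))
    (C ((degRevLex o).leadingCoeff g)⁻¹) (Ideal.subset_span ⟨g, hg, rfl⟩)
  rwa [MonomialOrder.leadingTerm, C_mul_monomial, inv_mul_cancel₀ hlc] at this

end IsSwapSystem
end GroebnerBasis

/-! ### Standard gradedness and strong Koszulness of the quotient -/

section StandardGraded

variable {σ k M : Type*} [Field k] [AddCommMonoid M]

attribute [local instance] MvPolynomial.gradedAlgebra in
theorem homogeneousComponent_mem_span {G : Set (MvPolynomial σ k)} {d : ℕ}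
    (hG : ∀ g ∈ G, g.IsHomogeneous d) {f : MvPolynomial σ k} (hf : f ∈ Ideal.span G) (n : ℕ) :
    homogeneousComponent n f ∈ Ideal.span G :=
  homogeneousComponent_mem_of_mem (Ideal.homogeneous_span _ _ fun g hg => ⟨d, hG g hg⟩) hf n

/-- The ideal lies in the d-th power of the ideal of the variables. Degree 0 gives a nontrivial
quotient, degree 1 the independence of the classes of the variables. -/
theorem coeff_eq_zero_of_mem_span {G : Set (MvPolynomial σ k)} {d : ℕ}
    (hG : ∀ g ∈ G, g.IsHomogeneous d) {f : MvPolynomial σ k} (hf : f ∈ Ideal.span G)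
    {u : σ →₀ ℕ} (hu : u.degree < d) : coeff u f = 0 := by
  have hle : Ideal.span G ≤ idealOfVars σ k ^ d := by
    refine Ideal.span_le.2 fun g hg => (mem_pow_idealOfVars_iff' _ _).2 fun v hv => ?_
    exact (hG g hg).coeff_eq_zero hv.ne
  exact (mem_pow_idealOfVars_iff' _ _).1 (hle hf) u hu

theorem span_range_mk_X (I : Ideal (MvPolynomial σ k)) :
    Submodule.span k (Set.range fun s => Ideal.Quotient.mk I (X s)) = quotientGrading I 1 := by
  rw [quotientGrading, homogeneousSubmodule_one_eq_span_X, Submodule.map_span, ← Set.range_comp]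
  rfl

theorem isInternal_quotientGrading {G : Set (MvPolynomial σ k)} {d : ℕ}
    (hG : ∀ g ∈ G, g.IsHomogeneous d) :
    DirectSum.IsInternal (quotientGrading (Ideal.span G)) := by
  classical
  constructor
  · rw [injective_iff_map_eq_zero]
    intro x hx
    have hrep : ∀ i, ∃ f : MvPolynomial σ k, f.IsHomogeneous i ∧
        Ideal.Quotient.mk (Ideal.span G) f = x i := fun i => (x i).2
    choose F hF hFx using hrep
    rw [DirectSum.coeAddMonoidHom_eq_dfinsuppSum, DFinsupp.sum] at hx
    simp only [← hFx] at hx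
    rw [← map_sum, Ideal.Quotient.eq_zero_iff_mem] at hx
    ext n
    by_cases hn : n ∈ DFinsupp.support x
    · have h1 := homogeneousComponent_mem_span hG hx n
      rw [map_sum, Finset.sum_eq_single n
        (fun i _ hi => by rw [homogeneousComponent_of_mem (hF i), if_neg hi.symm])
        (fun h => absurd hn h), homogeneousComponent_of_mem (hF n), if_pos rfl] at h1
      rw [← hFx n, Ideal.Quotient.eq_zero_iff_mem.2 h1]
      rfl
    · rw [DFinsupp.notMem_support_iff.1 hn]
      rfl
  · intro x
    obtain ⟨f, rfl⟩ := Ideal.Quotient.mk_surjective x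
    refine ⟨∑ i ∈ Finset.range (f.totalDegree + 1),
      DirectSum.of (fun i => quotientGrading (Ideal.span G) i) i
        ⟨Ideal.Quotient.mk _ (homogeneousComponent i f),
          ⟨_, homogeneousComponent_mem i f, rfl⟩⟩, ?_⟩
    rw [map_sum]
    simp only [DirectSum.coeAddMonoidHom_of]
    rw [← map_sum, sum_homogeneousComponent]

/-- Quotients by ideals generated by homogeneous polynomials of a common positive degree are
standard graded. -/
theorem isStandardGraded_quotientGrading [Finite σ] {G : Set (MvPolynomial σ k)} {d : ℕ}
    (hd : 0 < d) (hG : ∀ g ∈ G, g.IsHomogeneous d) :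
    IsStandardGraded (quotientGrading (Ideal.span G)) where
  gradedMonoid :=
    { one_mem := ⟨1, isHomogeneous_one σ k, map_one (Ideal.Quotient.mk _)⟩
      mul_mem := by
        rintro i j _ _ ⟨f, hf, rfl⟩ ⟨g, hg, rfl⟩
        exact ⟨f * g, IsHomogeneous.mul hf hg, map_mul (Ideal.Quotient.mk _) f g⟩ }
  isInternal := isInternal_quotientGrading hG
  nontrivial := by
    refine Ideal.Quotient.nontrivial_iff.2 fun h => ?_
    have := coeff_eq_zero_of_mem_span hG ((Ideal.eq_top_iff_one _).1 h) (u := 0) (by simpa)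
    simp at this
  zero_eq := by
    rw [quotientGrading, homogeneousSubmodule_zero, Submodule.map_one]
  adjoin_one := by
    rw [← span_range_mk_X, Algebra.adjoin_span]
    have := congrArg (Subalgebra.map (Ideal.Quotient.mkₐ k (Ideal.span G)))
      (adjoin_range_X (R := k) (σ := σ))
    rw [AlgHom.map_adjoin, ← Set.range_comp, Algebra.map_top,
      (AlgHom.range_eq_top _).2 (Ideal.Quotient.mkₐ_surjective k _)] at this
    exact this
  finite_one := by
    rw [← span_range_mk_X]
    exact Module.Finite.span_of_finite k (Set.finite_range _)

theorem linearIndependent_mk_X {G : Set (MvPolynomial σ k)} {d : ℕ}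
    (hd : 1 < d) (hG : ∀ g ∈ G, g.IsHomogeneous d) :
    LinearIndependent k fun s : σ => Ideal.Quotient.mk (Ideal.span G) (X s) := by
  classical
  rw [linearIndependent_iff]
  intro l hl
  have hmem : l.sum (fun s a => C a * X s) ∈ Ideal.span G := by
    rw [← Ideal.Quotient.eq_zero_iff_mem, ← hl, Finsupp.linearCombination_apply, map_finsuppSum]
    refine Finsupp.sum_congr fun s _ => ?_
    rw [← smul_eq_C_mul]
    exact map_smul (Ideal.Quotient.mkₐ k (Ideal.span G)) _ _
  ext s
  have := coeff_eq_zero_of_mem_span hG hmem (u := Finsupp.single s 1) (by simpa)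
  rw [Finsupp.sum, coeff_sum] at this
  simp only [coeff_C_mul, coeff_X] at this
  simpa [Finsupp.single_left_inj] using this

theorem IsSwapSystem.isStronglyKoszulQuotient [Finite σ] [IsCancelAdd M] {D : (σ →₀ ℕ) →+ M}
    {T : Set M} {G : Set (MvPolynomial σ k)} (h : IsSwapSystem D T G) :
    IsStronglyKoszulQuotient (Ideal.span G) where
  isStandardGraded := isStandardGraded_quotientGrading two_pos h.quadratic
  linearIndependent := linearIndependent_mk_X one_lt_two h.quadratic
  span_range := span_range_mk_X _
  colon_eq := by
    intro A i hi
    have hspan : ∀ (B : Set σ) (f : MvPolynomial σ k), Ideal.Quotient.mk (Ideal.span G) f ∈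
        Ideal.span ((fun s => Ideal.Quotient.mk (Ideal.span G) (X s)) '' B) ↔
        f ∈ Ideal.span G ⊔ Ideal.span (X '' B) := by
      intro B f
      rw [← Set.image_image (fun p => Ideal.Quotient.mk (Ideal.span G) p) X, ← Ideal.map_span,
        Ideal.mem_quotient_iff_mem_sup, sup_comm]
    -- The generators are the variables of A and those that x_i multiplies into the ideal; the
    -- inclusion of this ideal in the colon is immediate, the other one is `mem_of_mul_X_mem`.
    refine ⟨A ∪ {y | X y * X i ∈ Ideal.span G ⊔ Ideal.span (X '' A)}, ?_⟩
    ext r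
    obtain ⟨f, rfl⟩ := Ideal.Quotient.mk_surjective r
    rw [Submodule.mem_colon_singleton, smul_eq_mul, ← map_mul, hspan, hspan]
    refine ⟨h.mem_of_mul_X_mem hi, fun hf => ?_⟩
    have hle : Ideal.span G ⊔ Ideal.span
        (X '' (A ∪ {y | X y * X i ∈ Ideal.span G ⊔ Ideal.span (X '' A)})) ≤
        (Ideal.span G ⊔ Ideal.span (X '' A)).colon {X i} := by
      refine sup_le (fun p hp => ?_) (Ideal.span_le.2 ?_)
      · exact Submodule.mem_colon_singleton.2 (Ideal.mul_mem_right _ _ (Ideal.mem_sup_left hp))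
      · rintro _ ⟨y, hy | hy, rfl⟩
        · exact Submodule.mem_colon_singleton.2 (Ideal.mul_mem_right _ _
            (Ideal.mem_sup_right (Ideal.subset_span ⟨y, hy, rfl⟩)))
        · exact Submodule.mem_colon_singleton.2 hy
    exact Submodule.mem_colon_singleton.1 (hle hf)

end StandardGraded

/-! ### Matrices of variables and zeros, graded by row and column labels -/

section EntryMatrix

variable {σ V : Type*} {m n : ℕ}

/-- The matrix with entries zero or a variable, as prescribed by `ent`. -/
def entryMatrix (k : Type*) [Field k] (ent : Fin m → Fin n → Option σ) :
    Matrix (Fin m) (Fin n) (MvPolynomial σ k) :=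
  Matrix.of fun i j => (ent i j).elim 0 X

open Classical in
/-- The degree of a variable: the sum of its row and column labels if it is an entry of the
matrix, and a degree of its own otherwise. -/
def entryDegree (ent : Fin m → Fin n → Option σ) (r : Fin m → V) (c : Fin n → V) (s : σ) :
    (V →₀ ℕ) × (σ →₀ ℕ) :=
  if h : ∃ p : Fin m × Fin n, ent p.1 p.2 = some s then
    (Finsupp.single (r h.choose.1) 1 + Finsupp.single (c h.choose.2) 1, 0)
  else (0, Finsupp.single s 1)

/-- The grading of monomials induced by `entryDegree`. -/
def entryGrading (ent : Fin m → Fin n → Option σ) (r : Fin m → V) (c : Fin n → V) :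
    (σ →₀ ℕ) →+ (V →₀ ℕ) × (σ →₀ ℕ) :=
  (Finsupp.linearCombination ℕ (entryDegree ent r c)).toAddMonoidHom

/-- The degrees of the zero entries of the matrix. -/
def zeroEntryDegrees (ent : Fin m → Fin n → Option σ) (r : Fin m → V) (c : Fin n → V) :
    Set ((V →₀ ℕ) × (σ →₀ ℕ)) :=
  {t | ∃ i j, ent i j = none ∧ t = (Finsupp.single (r i) 1 + Finsupp.single (c j) 1, 0)}

theorem entryGrading_single (ent : Fin m → Fin n → Option σ) (r : Fin m → V) (c : Fin n → V)
    (s : σ) : entryGrading ent r c (Finsupp.single s 1) = entryDegree ent r c s := by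
  simp [entryGrading]

/-- A pattern of entries for which no variable repeats within a row or a column, in which the
position of a variable is determined up to its row and column labels, and which satisfies the
exchange property behind the 2-minors: a monomial whose degree is divisible by that of the
position `(i, j)`, but which is not divisible by the entry at that position, is divisible by the
product of an entry of row `i` and an entry of column `j`. -/
structure IsExchangePattern (ent : Fin m → Fin n → Option σ) (r : Fin m → V) (c : Fin n → V) :
    Prop where
  row_injective : ∀ i j l s, ent i j = some s → ent i l = some s → j = l
  col_injective : ∀ i k j s, ent i j = some s → ent k j = some s → i = k
  label_eq : ∀ i j k l s, ent i j = some s → ent k l = some s →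
    Finsupp.single (r i) 1 + Finsupp.single (c j) 1 =
      (Finsupp.single (r k) 1 + Finsupp.single (c l) 1 : V →₀ ℕ)
  exchange : ∀ i j (u : σ →₀ ℕ),
    Finsupp.single (r i) 1 + Finsupp.single (c j) 1 ≤ (entryGrading ent r c u).1 →
    (∀ s, ent i j = some s → u s = 0) →
    ∃ k l y z, ent i l = some y ∧ ent k j = some z ∧
      Finsupp.single y 1 + Finsupp.single z 1 ≤ u

theorem entryDegree_of_notMem {ent : Fin m → Fin n → Option σ} {r : Fin m → V} {c : Fin n → V}
    {s : σ} (hs : ¬ ∃ p : Fin m × Fin n, ent p.1 p.2 = some s) :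
    entryDegree ent r c s = (0, Finsupp.single s 1) :=
  dif_neg hs

theorem entryGrading_apply (ent : Fin m → Fin n → Option σ) (r : Fin m → V) (c : Fin n → V)
    (u : σ →₀ ℕ) : entryGrading ent r c u = ∑ s ∈ u.support, u s • entryDegree ent r c s :=
  Finsupp.linearCombination_apply _ _

/-- A label occurring in the degree of a monomial is the label of one of its variables. -/
theorem exists_entry_of_fst_ne_zero {ent : Fin m → Fin n → Option σ} {r : Fin m → V}
    {c : Fin n → V} {u : σ →₀ ℕ} {v : V} (h : (entryGrading ent r c u).1 v ≠ 0) :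
    ∃ s i j, u s ≠ 0 ∧ ent i j = some s ∧ (v = r i ∨ v = c j) := by
  classical
  rw [entryGrading_apply, Prod.fst_sum, Finsupp.finsetSum_apply] at h
  obtain ⟨s, hs, hne⟩ := Finset.exists_ne_zero_of_sum_ne_zero h
  rw [entryDegree] at hne
  split_ifs at hne with hp
  · refine ⟨s, hp.choose.1, hp.choose.2, Finsupp.mem_support_iff.1 hs, hp.choose_spec, ?_⟩
    by_contra! hv
    simp [hv.1.symm, hv.2.symm] at hne
  · simp at hne

theorem apply_ne_zero_of_snd_ne_zero {ent : Fin m → Fin n → Option σ} {r : Fin m → V}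
    {c : Fin n → V} {u : σ →₀ ℕ} {x : σ} (h : (entryGrading ent r c u).2 x ≠ 0) : u x ≠ 0 := by
  classical
  rw [entryGrading_apply, Prod.snd_sum, Finsupp.finsetSum_apply] at h
  obtain ⟨s, hs, hne⟩ := Finset.exists_ne_zero_of_sum_ne_zero h
  rw [entryDegree] at hne
  split_ifs at hne with hp
  · simp at hne
  · by_cases hsx : s = x
    · exact hsx ▸ Finsupp.mem_support_iff.1 hs
    · simp [hsx] at hne

/-- An entry contributes two labels, any other variable a single unit in the second component, hence
the factor 2 there. Thus the grading determines the degree of a monomial. -/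
theorem degree_entryGrading (ent : Fin m → Fin n → Option σ) (r : Fin m → V) (c : Fin n → V)
    (u : σ →₀ ℕ) :
    (entryGrading ent r c u).1.degree + 2 * (entryGrading ent r c u).2.degree = 2 * u.degree := by
  induction u using Finsupp.induction_linear with
  | zero => simp
  | add u v hu hv =>
    simp only [map_add, Prod.fst_add, Prod.snd_add]
    omega
  | single s a =>
    have : Finsupp.single s a = a • Finsupp.single s 1 := by simp
    rw [this, map_nsmul, entryGrading_single]
    simp only [Prod.smul_fst, Prod.smul_snd, map_nsmul, Finsupp.degree_single, smul_eq_mul]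
    have : (entryDegree ent r c s).1.degree + 2 * (entryDegree ent r c s).2.degree = 2 := by
      rw [entryDegree]
      split_ifs <;> simp
    linear_combination a * this

/-- This makes the arbitrary choice of position in `entryDegree` harmless: all positions of a
variable carry the same labels. -/
theorem entryDegree_eq {ent : Fin m → Fin n → Option σ} {r : Fin m → V} {c : Fin n → V}
    (hlabel : ∀ i j k l s, ent i j = some s → ent k l = some s →
      Finsupp.single (r i) 1 + Finsupp.single (c j) 1 =
        (Finsupp.single (r k) 1 + Finsupp.single (c l) 1 : V →₀ ℕ))
    {i : Fin m} {j : Fin n} {s : σ} (hs : ent i j = some s) :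
    entryDegree ent r c s = (Finsupp.single (r i) 1 + Finsupp.single (c j) 1, 0) := by
  have hp : ∃ p : Fin m × Fin n, ent p.1 p.2 = some s := ⟨(i, j), hs⟩
  rw [entryDegree, dif_pos hp, hlabel _ _ _ _ s hp.choose_spec hs]

/-! ### The 2-minors as quadrics -/

section Minors

variable (k : Type*) [Field k]

/-- The 2-minor with rows `i`, `p` and columns `l`, `j`. -/
def entryMinor (ent : Fin m → Fin n → Option σ) (i p : Fin m) (l j : Fin n) :
    MvPolynomial σ k :=
  entryMatrix k ent i l * entryMatrix k ent p j - entryMatrix k ent i j * entryMatrix k ent p l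

/-- The nonzero 2-minors. -/
def entryMinors (ent : Fin m → Fin n → Option σ) : Set (MvPolynomial σ k) :=
  {f | ∃ (r : Fin 2 ↪o Fin m) (c : Fin 2 ↪o Fin n),
    f = ((entryMatrix k ent).submatrix r c).det} \ {0}

variable {k}

theorem span_entryMinors (ent : Fin m → Fin n → Option σ) :
    Ideal.span (entryMinors k ent) = minorsIdeal 2 (entryMatrix k ent) :=
  Ideal.span_sdiff_singleton_zero

theorem entryMinors_finite (ent : Fin m → Fin n → Option σ) : (entryMinors k ent).Finite := by
  have : Finite (Fin 2 ↪o Fin m) := DFunLike.finite _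
  have : Finite (Fin 2 ↪o Fin n) := DFunLike.finite _
  refine Set.Finite.subset (Set.finite_range fun q : (Fin 2 ↪o Fin m) × (Fin 2 ↪o Fin n) =>
    ((entryMatrix k ent).submatrix q.1 q.2).det) ?_
  rintro f ⟨⟨r, c, rfl⟩, -⟩
  exact ⟨(r, c), rfl⟩

theorem exists_of_mem_entryMinors {ent : Fin m → Fin n → Option σ} {f : MvPolynomial σ k}
    (hf : f ∈ entryMinors k ent) :
    ∃ i p l j, i ≠ p ∧ l ≠ j ∧ f = entryMinor k ent i p l j := by
  obtain ⟨⟨r, c, rfl⟩, -⟩ := hf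
  exact ⟨r 0, r 1, c 0, c 1, fun h => by simpa using r.injective h,
    fun h => by simpa using c.injective h, Matrix.det_fin_two _⟩

theorem exists_orderEmbedding_of_lt {a b : Fin n} (h : a < b) :
    ∃ e : Fin 2 ↪o Fin n, e 0 = a ∧ e 1 = b := by
  refine ⟨OrderEmbedding.ofStrictMono ![a, b] ?_, rfl, rfl⟩
  rw [Fin.strictMono_iff_lt_succ]
  intro i
  fin_cases i
  exact h

/-- Sorting the two rows and the two columns changes a minor at most by a sign. -/
theorem exists_mem_entryMinors {ent : Fin m → Fin n → Option σ} {i p : Fin m} {l j : Fin n}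
    (hip : i ≠ p) (hlj : l ≠ j) (h0 : entryMinor k ent i p l j ≠ 0) :
    ∃ g ∈ entryMinors k ent, g = entryMinor k ent i p l j ∨ g = -entryMinor k ent i p l j := by
  suffices h : ∃ (r : Fin 2 ↪o Fin m) (c : Fin 2 ↪o Fin n),
      ((entryMatrix k ent).submatrix r c).det = entryMinor k ent i p l j ∨
        ((entryMatrix k ent).submatrix r c).det = -entryMinor k ent i p l j by
    obtain ⟨r, c, h⟩ := h
    refine ⟨_, ⟨⟨r, c, rfl⟩, ?_⟩, h⟩
    rcases h with h | h <;> simpa [h] using h0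
  simp only [Matrix.det_fin_two, Matrix.submatrix_apply, entryMinor]
  rcases hip.lt_or_gt with h1 | h1 <;> rcases hlj.lt_or_gt with h2 | h2 <;>
    obtain ⟨r, hr0, hr1⟩ := exists_orderEmbedding_of_lt h1 <;>
    obtain ⟨c, hc0, hc1⟩ := exists_orderEmbedding_of_lt h2 <;>
    refine ⟨r, c, ?_⟩ <;> rw [hr0, hr1, hc0, hc1]
  · left; ring
  · right; ring
  · right; ring
  · left; ring

theorem entryMatrix_isHomogeneous (ent : Fin m → Fin n → Option σ) (i : Fin m) (j : Fin n) :
    (entryMatrix k ent i j).IsHomogeneous 1 := by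
  rw [entryMatrix, Matrix.of_apply]
  cases ent i j with
  | none => exact isHomogeneous_zero _ _ _
  | some s => exact isHomogeneous_X _ s

theorem entryMinor_isHomogeneous (ent : Fin m → Fin n → Option σ) (i p : Fin m) (l j : Fin n) :
    (entryMinor k ent i p l j).IsHomogeneous 2 :=
  ((entryMatrix_isHomogeneous ent i l).mul (entryMatrix_isHomogeneous ent p j)).sub
    ((entryMatrix_isHomogeneous ent i j).mul (entryMatrix_isHomogeneous ent p l))

theorem exists_of_mem_support_mul {ent : Fin m → Fin n → Option σ} {i p : Fin m} {l j : Fin n}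
    {a : σ →₀ ℕ} (ha : a ∈ (entryMatrix k ent i l * entryMatrix k ent p j).support) :
    ∃ y z, ent i l = some y ∧ ent p j = some z ∧
      a = Finsupp.single y 1 + Finsupp.single z 1 := by
  classical
  rw [entryMatrix, Matrix.of_apply, Matrix.of_apply] at ha
  cases hy : ent i l with
  | none => simp [hy] at ha
  | some y =>
    cases hz : ent p j with
    | none => simp [hz] at ha
    | some z =>
      refine ⟨y, z, rfl, rfl, ?_⟩
      rw [hy, hz, Option.elim_some, Option.elim_some, X_mul_X_eq_monomial] at ha
      exact Finset.mem_singleton.1 (support_monomial_subset ha)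

end Minors

/-! ### From the exchange property to a swap system -/

namespace IsExchangePattern

variable {ent : Fin m → Fin n → Option σ} {r : Fin m → V} {c : Fin n → V}
  {k : Type*} [Field k]

/-- Any entry of the diagonal product and any entry of the antidiagonal product share a row or a
column, so they cannot be the same variable. -/
theorem isTidy_entryMinor (h : IsExchangePattern ent r c) {i p : Fin m} {l j : Fin n}
    (hip : i ≠ p) (hlj : l ≠ j) : IsTidy (entryMinor k ent i p l j) where
  homogeneous := ⟨2, entryMinor_isHomogeneous ent i p l j⟩
  unique := by
    classical
    have hdisj : ∀ (s : σ) (a b : σ →₀ ℕ),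
        a ∈ (entryMatrix k ent i l * entryMatrix k ent p j).support →
        b ∈ (entryMatrix k ent i j * entryMatrix k ent p l).support → a s ≠ 0 → b s ≠ 0 →
        False := by
      intro s a b ha hb has hbs
      obtain ⟨y, z, hy, hz, rfl⟩ := exists_of_mem_support_mul ha
      obtain ⟨x, w, hx, hw, rfl⟩ := exists_of_mem_support_mul hb
      have h1 : y = s ∨ z = s := by
        by_contra! hne; simp [hne.1.symm, hne.2.symm] at has
      have h2 : x = s ∨ w = s := by
        by_contra! hne; simp [hne.1.symm, hne.2.symm] at hbs
      rcases h1 with rfl | rfl <;> rcases h2 with rfl | rfl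
      · exact hlj (h.row_injective _ _ _ _ hy hx)
      · exact hip (h.col_injective _ _ _ _ hy hw)
      · exact hip (h.col_injective _ _ _ _ hx hz)
      · exact hlj (h.row_injective _ _ _ _ hw hz)
    have hsame : ∀ (i p : Fin m) (l j : Fin n) (a b : σ →₀ ℕ),
        a ∈ (entryMatrix k ent i l * entryMatrix k ent p j).support →
        b ∈ (entryMatrix k ent i l * entryMatrix k ent p j).support → a = b := by
      intro i p l j a b ha hb
      obtain ⟨y, z, hy, hz, rfl⟩ := exists_of_mem_support_mul ha
      obtain ⟨x, w, hx, hw, rfl⟩ := exists_of_mem_support_mul hb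
      rw [Option.some.inj (hy.symm.trans hx), Option.some.inj (hz.symm.trans hw)]
    intro s a ha b hb has hbs
    rcases Finset.mem_union.1 (support_sub _ _ _ ha) with ha | ha <;>
      rcases Finset.mem_union.1 (support_sub _ _ _ hb) with hb | hb
    · exact hsame _ _ _ _ a b ha hb
    · exact (hdisj s a b ha hb has hbs).elim
    · exact (hdisj s b a hb ha hbs has).elim
    · exact hsame _ _ _ _ a b ha hb

theorem entryGrading_pair (h : IsExchangePattern ent r c) {i p : Fin m} {l j : Fin n} {y z : σ}
    (hy : ent i l = some y) (hz : ent p j = some z) :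
    entryGrading ent r c (Finsupp.single y 1 + Finsupp.single z 1) =
      (Finsupp.single (r i) 1 + Finsupp.single (c l) 1 +
        (Finsupp.single (r p) 1 + Finsupp.single (c j) 1), 0) := by
  rw [map_add, entryGrading_single, entryGrading_single, entryDegree_eq h.label_eq hy,
    entryDegree_eq h.label_eq hz, Prod.mk_add_mk, add_zero]

theorem mul_mem_gradedIdeal (h : IsExchangePattern ent r c) {i p : Fin m} {l j : Fin n}
    (h0 : ent i j = none ∨ ent p l = none) :
    entryMatrix k ent i l * entryMatrix k ent p j ∈
      gradedIdeal k (entryGrading ent r c) (zeroEntryDegrees ent r c) := by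
  rw [entryMatrix, Matrix.of_apply, Matrix.of_apply]
  cases hy : ent i l with
  | none => simp
  | some y =>
    cases hz : ent p j with
    | none => simp
    | some z =>
      rw [Option.elim_some, Option.elim_some, X_mul_X_eq_monomial]
      rcases h0 with h0 | h0
      · have ht : (Finsupp.single (r i) 1 + Finsupp.single (c j) 1, 0) ∈
            zeroEntryDegrees ent r c := ⟨i, j, h0, rfl⟩
        refine monomial_mem_gradedIdeal ht
          (m := (Finsupp.single (r p) 1 + Finsupp.single (c l) 1, 0)) ?_ 1
        rw [h.entryGrading_pair hy hz, Prod.mk_add_mk, add_zero]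
        congr 1; abel
      · have ht : (Finsupp.single (r p) 1 + Finsupp.single (c l) 1, 0) ∈
            zeroEntryDegrees ent r c := ⟨p, l, h0, rfl⟩
        refine monomial_mem_gradedIdeal ht
          (m := (Finsupp.single (r i) 1 + Finsupp.single (c j) 1, 0)) ?_ 1
        rw [h.entryGrading_pair hy hz, Prod.mk_add_mk, add_zero]
        congr 1; abel

/-- Both products use the same two rows and two columns, hence have equal degree and cancel. If one
product vanishes, the degree of the other is divisible by that of a zero position. -/
theorem entryMinor_mem_gradedIdeal (h : IsExchangePattern ent r c) (i p : Fin m) (l j : Fin n) :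
    entryMinor k ent i p l j ∈
      gradedIdeal k (entryGrading ent r c) (zeroEntryDegrees ent r c) := by
  by_cases h1 : ent i j = none ∨ ent p l = none
  · refine sub_mem (h.mul_mem_gradedIdeal h1) ?_
    have : entryMatrix k ent i j * entryMatrix k ent p l = 0 := by
      rw [entryMatrix, Matrix.of_apply, Matrix.of_apply]
      rcases h1 with h1 | h1 <;> simp [h1]
    rw [this]
    exact Ideal.zero_mem _
  by_cases h2 : ent i l = none ∨ ent p j = none
  · refine sub_mem ?_ (h.mul_mem_gradedIdeal h2)
    have : entryMatrix k ent i l * entryMatrix k ent p j = 0 := by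
      rw [entryMatrix, Matrix.of_apply, Matrix.of_apply]
      rcases h2 with h2 | h2 <;> simp [h2]
    rw [this]
    exact Ideal.zero_mem _
  simp only [not_or, ← ne_eq, Option.ne_none_iff_exists'] at h1 h2
  obtain ⟨⟨x, hx⟩, ⟨w, hw⟩⟩ := h1
  obtain ⟨⟨y, hy⟩, ⟨z, hz⟩⟩ := h2
  rw [gradedIdeal, Ideal.mem_comap, entryMinor, entryMatrix]
  simp only [Matrix.of_apply, hx, hy, hz, hw, Option.elim_some, X_mul_X_eq_monomial, map_sub,
    gradingMap_monomial]
  rw [h.entryGrading_pair hy hz, h.entryGrading_pair hx hw]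
  convert Ideal.zero_mem _
  rw [sub_eq_zero]
  congr 2; abel

/-- The nonzero 2-minors of a matrix with an exchange pattern form a swap system. -/
theorem isSwapSystem (h : IsExchangePattern ent r c) :
    IsSwapSystem (entryGrading ent r c) (zeroEntryDegrees ent r c) (entryMinors k ent) where
  finite := entryMinors_finite ent
  tidy g hg := by
    obtain ⟨i, p, l, j, hip, hlj, rfl⟩ := exists_of_mem_entryMinors hg
    exact h.isTidy_entryMinor hip hlj
  ne_zero g hg := hg.2
  quadratic g hg := by
    obtain ⟨i, p, l, j, -, -, rfl⟩ := exists_of_mem_entryMinors hg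
    exact entryMinor_isHomogeneous ent i p l j
  graded g hg := by
    obtain ⟨i, p, l, j, -, -, rfl⟩ := exists_of_mem_entryMinors hg
    exact h.entryMinor_mem_gradedIdeal i p l j
  degree_eq u v huv := by
    have h1 := degree_entryGrading ent r c u
    have h2 := degree_entryGrading ent r c v
    rw [huv] at h1
    omega
  swap x u a hu hux := by
    classical
    rw [entryGrading_single] at hu
    by_cases hx : ∃ p : Fin m × Fin n, ent p.1 p.2 = some x
    · obtain ⟨⟨i, j⟩, hx⟩ := hx
      have hu0 : ∀ s, ent i j = some s → u s = 0 := by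
        intro s hs
        rwa [← Option.some.inj (hx.symm.trans hs)]
      obtain ⟨p, l, y, z, hy, hz, hyz⟩ := h.exchange i j u
        (by rw [hu, entryDegree_eq h.label_eq hx]; exact le_add_self) hu0
      have huy : u y ≠ 0 := by
        have := hyz y
        simp only [Finsupp.add_apply, Finsupp.single_eq_same] at this
        omega
      have huz : u z ≠ 0 := by
        have := hyz z
        simp only [Finsupp.add_apply, Finsupp.single_eq_same] at this
        omega
      -- Equal rows or columns would put z or y at position (i,j), whose entry does not divide u.
      have hip : i ≠ p := by rintro rfl; exact huz (hu0 z hz)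
      have hlj : l ≠ j := by rintro rfl; exact huy (hu0 y hy)
      refine ⟨y, z, hyz, ?_⟩
      cases hw : ent p l with
      | none =>
        have hf : entryMinor k ent i p l j = X y * X z := by
          simp [entryMinor, entryMatrix, hy, hz, hw]
        rw [← hf]
        exact Or.inl (exists_mem_entryMinors hip hlj (by simp [hf]))
      | some w =>
        refine Or.inr ⟨w, ?_, ?_⟩
        · rw [h.entryGrading_pair hy hz, h.entryGrading_pair hx hw]
          congr 1; abel
        · have hf : entryMinor k ent i p l j = X y * X z - X x * X w := by
            simp [entryMinor, entryMatrix, hx, hy, hz, hw]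
          rw [← hf]
          refine exists_mem_entryMinors hip hlj ?_
          -- The minor is nonzero because x divides xw but not yz, as y and z divide u and x does
          -- not.
          rw [hf, sub_ne_zero, X_mul_X_eq_monomial, X_mul_X_eq_monomial]
          intro heq
          have hxy : x ≠ y := fun h => huy (h ▸ hux)
          have hxz : x ≠ z := fun h => huz (h ▸ hux)
          have := DFunLike.congr_fun (monomial_left_injective one_ne_zero heq) x
          simp [hxy, hxz] at this
          omega
    -- A variable outside the matrix has a degree of its own, so it already divides u.
    · rw [entryDegree_of_notMem hx] at hu
      refine absurd hux (apply_ne_zero_of_snd_ne_zero (ent := ent) (r := r) (c := c) ?_)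
      rw [hu]
      simp
  kill u a t ht hu := by
    obtain ⟨i, j, hij, rfl⟩ := ht
    obtain ⟨p, l, y, z, hy, hz, hyz⟩ := h.exchange i j u (by rw [hu]; exact le_add_self)
      (by simp [hij])
    have hip : i ≠ p := by rintro rfl; simp [hij] at hz
    have hlj : l ≠ j := by rintro rfl; simp [hij] at hy
    refine ⟨y, z, hyz, ?_⟩
    have hf : entryMinor k ent i p l j = X y * X z := by
      simp [entryMinor, entryMatrix, hy, hz, hij]
    rw [← hf]
    exact exists_mem_entryMinors hip hlj (by simp [hf])

theorem minorsIdeal_two [Finite σ] (h : IsExchangePattern ent r c) :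
    HasTidyQuadraticRevlexUniversalGB (minorsIdeal 2 (entryMatrix k ent)) ∧
      IsStronglyKoszulQuotient (minorsIdeal 2 (entryMatrix k ent)) := by
  rw [← span_entryMinors]
  exact ⟨h.isSwapSystem.hasTidyQuadraticRevlexUniversalGB,
    h.isSwapSystem.isStronglyKoszulQuotient⟩

end IsExchangePattern

/-! ### The exchange property for generic and symmetric patterns -/

theorem single_add_single_le {u : σ →₀ ℕ} {y z : σ} (hyz : y ≠ z) (hy : u y ≠ 0) (hz : u z ≠ 0) :
    Finsupp.single y 1 + Finsupp.single z 1 ≤ u := by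
  classical
  intro s
  simp only [Finsupp.add_apply, Finsupp.single_apply]
  split_ifs with h1 h2 h2
  · exact absurd (h1.trans h2.symm) hyz
  · subst h1; omega
  · subst h2; omega
  · omega

/-- The pattern of a generic matrix, with rows and columns labelled independently. -/
theorem isExchangePattern_generic {ent : Fin m → Fin n → Option σ}
    (hinj : ∀ i j k l s, ent i j = some s → ent k l = some s → i = k ∧ j = l) :
    IsExchangePattern ent (Sum.inl : Fin m → Fin m ⊕ Fin n) Sum.inr where
  row_injective i j l s h1 h2 := (hinj _ _ _ _ s h1 h2).2
  col_injective i k j s h1 h2 := (hinj _ _ _ _ s h1 h2).1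
  label_eq i j k l s h1 h2 := by
    obtain ⟨rfl, rfl⟩ := hinj _ _ _ _ s h1 h2
    rfl
  exchange i j u hle hu := by
    obtain ⟨y, i', l, huy, hy, h1⟩ := exists_entry_of_fst_ne_zero (v := Sum.inl i)
      (ent := ent) (r := Sum.inl) (c := Sum.inr) (u := u) (by
        have := hle (Sum.inl i)
        simp at this
        omega)
    obtain ⟨z, p, j', huz, hz, h2⟩ := exists_entry_of_fst_ne_zero (v := Sum.inr j)
      (ent := ent) (r := Sum.inl) (c := Sum.inr) (u := u) (by
        have := hle (Sum.inr j)
        simp at this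
        omega)
    obtain rfl : i = i' := by simpa using h1
    obtain rfl : j = j' := by simpa using h2
    -- If y and z were one variable, it would be the entry at (i,j), which does not divide u.
    refine ⟨p, l, y, z, hy, hz, single_add_single_le ?_ huy huz⟩
    rintro rfl
    obtain ⟨rfl, rfl⟩ := hinj _ _ _ _ y hy hz
    exact huy (hu y hy)

/-- The pattern of a symmetric matrix, with rows and columns labelled alike. -/
theorem isExchangePattern_symmetric {ent : Fin n → Fin n → Option σ}
    (hsymm : ∀ i j, ent i j = ent j i)
    (hinj : ∀ i j k l s, ent i j = some s → ent k l = some s → s(i, j) = s(k, l)) :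
    IsExchangePattern ent (id : Fin n → Fin n) id := by
  have hlabel : ∀ i j k l s, ent i j = some s → ent k l = some s →
      Finsupp.single (id i) 1 + Finsupp.single (id j) 1 =
        (Finsupp.single (id k) 1 + Finsupp.single (id l) 1 : Fin n →₀ ℕ) := by
    intro i j k l s h1 h2
    rcases Sym2.eq_iff.1 (hinj _ _ _ _ s h1 h2) with ⟨rfl, rfl⟩ | ⟨rfl, rfl⟩
    · rfl
    · exact add_comm _ _
  refine ⟨fun i j l s h1 h2 => ?_, fun i k j s h1 h2 => ?_, hlabel, fun i j u hle hu => ?_⟩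
  · exact Sym2.congr_right.1 (hinj _ _ _ _ s h1 h2)
  · exact Sym2.congr_left.1 (hinj _ _ _ _ s h1 h2)
  have hrow : ∀ (i : Fin n) (u : σ →₀ ℕ), (entryGrading ent id id u).1 i ≠ 0 →
      ∃ y l, u y ≠ 0 ∧ ent i l = some y := by
    intro i u hi
    obtain ⟨y, a, b, huy, hy, rfl | rfl⟩ := exists_entry_of_fst_ne_zero hi
    · exact ⟨y, b, huy, hy⟩
    · exact ⟨y, a, huy, (hsymm _ _).trans hy⟩
  obtain ⟨y, l, huy, hy⟩ := hrow i u (by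
    have := hle i
    simp at this
    omega)
  by_cases hij : i = j
  · subst hij
    -- On the diagonal the label i is needed twice. The variable y is off-diagonal and uses it once,
    -- so it still occurs after y is divided out. Here z = y is possible, so y and z must be
    -- extracted successively.
    have hli : l ≠ i := by rintro rfl; exact huy (hu y hy)
    have hyu : Finsupp.single y 1 ≤ u := by
      rw [Finsupp.single_le_iff]
      exact Nat.one_le_iff_ne_zero.2 huy
    obtain ⟨u', rfl⟩ := exists_add_of_le hyu
    obtain ⟨z, p, huz, hz⟩ := hrow i u' (by
      have := hle i
      rw [map_add, entryGrading_single, entryDegree_eq hlabel hy] at this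
      simp [hli.symm] at this
      omega)
    rw [hsymm] at hz
    refine ⟨p, l, y, z, hy, hz, ?_⟩
    gcongr
    rw [Finsupp.single_le_iff]
    exact Nat.one_le_iff_ne_zero.2 huz
  · obtain ⟨z, p, huz, hz⟩ := hrow j u (by
      have := hle j
      simp at this
      omega)
    rw [hsymm] at hz
    refine ⟨p, l, y, z, hy, hz, single_add_single_le ?_ huy huz⟩
    rintro rfl
    -- A variable lying in row i and in column j is the entry at (i,j), since i ≠ j.
    rcases Sym2.eq_iff.1 (hinj _ _ _ _ y hy hz) with ⟨rfl, rfl⟩ | ⟨h1, -⟩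
    · exact huy (hu y hy)
    · exact hij h1

end EntryMatrix

end SparseMinors

end

/-! ### The four sparse matrices as instances -/

theorem mainTheorem6 (k : Type*) [Field k] :
    (∀ (m n : ℕ) (G : SimpleGraph (Fin m ⊕ Fin n)),
      G.IsBipartiteWith (Set.range Sum.inl) (Set.range Sum.inr) →
        (SparseMinors.HasTidyQuadraticRevlexUniversalGB
            (SparseMinors.minorsIdeal 2 (SparseMinors.sparseGenericMatrix k G)) ∧
          SparseMinors.IsStronglyKoszulQuotient
            (SparseMinors.minorsIdeal 2 (SparseMinors.sparseGenericMatrix k G))) ∧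
        (SparseMinors.HasTidyQuadraticRevlexUniversalGB
            (SparseMinors.minorsIdeal 2 (SparseMinors.sparseGenericMatrixSurviving k G)) ∧
          SparseMinors.IsStronglyKoszulQuotient
            (SparseMinors.minorsIdeal 2 (SparseMinors.sparseGenericMatrixSurviving k G)))) ∧
    (∀ (n : ℕ) (H : Set (Sym2 (Fin n))),
        (SparseMinors.HasTidyQuadraticRevlexUniversalGB
            (SparseMinors.minorsIdeal 2 (SparseMinors.sparseSymmetricMatrix k H)) ∧
          SparseMinors.IsStronglyKoszulQuotient
            (SparseMinors.minorsIdeal 2 (SparseMinors.sparseSymmetricMatrix k H))) ∧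
        (SparseMinors.HasTidyQuadraticRevlexUniversalGB
            (SparseMinors.minorsIdeal 2 (SparseMinors.sparseSymmetricMatrixSurviving k H)) ∧
          SparseMinors.IsStronglyKoszulQuotient
            (SparseMinors.minorsIdeal 2 (SparseMinors.sparseSymmetricMatrixSurviving k H)))) := by
  classical
  refine ⟨fun m n G _ => ⟨?_, ?_⟩, fun n H => ⟨?_, ?_⟩⟩
  · have hM : SparseMinors.sparseGenericMatrix k G = SparseMinors.entryMatrix k
        (fun i j => if G.Adj (Sum.inl i) (Sum.inr j) then none else some (i, j)) := by
      ext1 i j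
      simp only [SparseMinors.sparseGenericMatrix, SparseMinors.entryMatrix, Matrix.of_apply]
      split_ifs <;> rfl
    rw [hM]
    refine (SparseMinors.isExchangePattern_generic ?_).minorsIdeal_two
    intro i j p l s h1 h2
    split_ifs at h1 h2
    exact Prod.mk.inj (Option.some.inj (h1.trans h2.symm))
  · have hM : SparseMinors.sparseGenericMatrixSurviving k G = SparseMinors.entryMatrix k
        (fun i j => if h : G.Adj (Sum.inl i) (Sum.inr j) then none else some ⟨(i, j), h⟩) := by
      ext1 i j
      simp only [SparseMinors.sparseGenericMatrixSurviving, SparseMinors.entryMatrix,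
        Matrix.of_apply]
      split_ifs <;> rfl
    rw [hM]
    refine (SparseMinors.isExchangePattern_generic ?_).minorsIdeal_two
    intro i j p l s h1 h2
    split_ifs at h1 h2
    exact Prod.mk.inj (Subtype.mk.inj (Option.some.inj (h1.trans h2.symm)))
  · have hM : SparseMinors.sparseSymmetricMatrix k H = SparseMinors.entryMatrix k
        (fun i j => if s(i, j) ∈ H then none else some s(i, j)) := by
      ext1 i j
      simp only [SparseMinors.sparseSymmetricMatrix, SparseMinors.entryMatrix, Matrix.of_apply]
      split_ifs <;> rfl
    rw [hM]
    refine (SparseMinors.isExchangePattern_symmetric ?_ ?_).minorsIdeal_two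
    · intro i j
      simp only [Sym2.eq_swap (a := i)]
    · intro i j p l s h1 h2
      split_ifs at h1 h2
      exact Option.some.inj (h1.trans h2.symm)
  · have hM : SparseMinors.sparseSymmetricMatrixSurviving k H = SparseMinors.entryMatrix k
        (fun i j => if h : s(i, j) ∈ H then none else some ⟨s(i, j), h⟩) := by
      ext1 i j
      simp only [SparseMinors.sparseSymmetricMatrixSurviving, SparseMinors.entryMatrix,
        Matrix.of_apply]
      split_ifs <;> rfl
    rw [hM]
    refine (SparseMinors.isExchangePattern_symmetric ?_ ?_).minorsIdeal_two
    · intro i j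
      simp only [Sym2.eq_swap (a := i)]
    · intro i j p l s h1 h2
      split_ifs at h1 h2
      exact Subtype.mk.inj (Option.some.inj (h1.trans h2.symm))
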